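/- **Setting.** Fix a set $\mathcal S$ of statements. A derivation rule $\mathsf r$ consists of an arity $\mathrm{ar}(\mathsf r)\in\mathbb N$, a partial function $\mathsf r:\mathcal S^{\mathrm{ar}(\mathsf r)}\rightharpoonup\mathcal S$ sending premisses to the conclusion, and a map $\mathrm{co}_{\mathsf r}:\{1,\dots,\mathrm{ar}(\mathsf r)\}\to\{0,1\}$; the $i$th premiss is called coinductive if $\mathrm{co}_{\mathsf r}(i)=1$ and inductive otherwise. Fix a family $\mathcal D$ of derivation rules. Let $\mathcal T$ be the set of all (possibly non-wellfounded) derivation trees generated by $\mathcal D$, with nodes labelled by rules and statements, such that every infinite branch crosses infinitely many coinductive premisses. We write $s=\mathsf r(s_1,\dots,s_k)$ if the last rule of $s$ is $\mathsf r$ and its immediate subtrees are $s_1,\dots,s_k$. For each $A\in\mathcal S$ let $\mathsf{trunc}_A$ be a fresh nullary rule with conclusion $A$. The truncation of $s\in\mathcal T$ at depth $d\in\mathbb N$ is given by $\lfloor s\rfloor_0=\mathsf{trunc}_A()$, where $A$ is the conclusion of $s$, and $\lfloor \mathsf r(s_1,\dots,s_k)\rfloor_{d+1}=\mathsf r(\lfloor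 s_1\rfloor_{d+1-\mathrm{co}_{\mathsf r}(1)},\dots,\lfloor s_k\rfloor_{d+1-\mathrm{co}_{\mathsf r}(k)})$. Put $\mathbf d(s,t)=\inf\{2^{-d}\mid \lfloor s\rfloor_d=\lfloor t\rfloor_d\}\in[0,\infty]$ (with $\inf\emptyset=\infty$). Let $\to_0\;\subseteq\mathcal T\times\mathcal T$ be a set of zero steps, each of which relates two derivations with the same conclusion. The relations $\to_d$ ($d\in\mathbb N$) are generated inductively by: every zero step is a step $\to_0$; and if $s_i\to_d s_i'$ then $\mathsf r(s_1,\dots,s_i,\dots,s_k)\to_{d+\mathrm{co}_{\mathsf r}(i)}\mathsf r(s_1,\dots,s_i',\dots,s_k)$. Let $\to\;=\bigcup_d\to_d$ and let $\to^*$ be its reflexive-transitive closure. A strongly converging rewriting sequence of ordinal length $\gamma$ from $s$ to $t$ consists of trees $(s_\delta)_{\delta\le\gamma}$ in $\mathcal T$ with $s_0=s$, $s_\gamma=t$, and of steps $s_\delta\to_{d_\delta}s_{\delta+1}$ for $\delta<\gamma$, such that for every limit ordinal $\gamma'\le\gamma$ one has $\lim_{\delta\to\gamma'}s_\delta=s_{\gamma'}$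 with respect to $\mathbf d$ and $\lim_{\delta\to\gamma'}d_\delta=\infty$. Write $s\to^\infty t$ if there is a strongly converging rewriting sequence, of any ordinal length, from $s$ to $t$. For ordinals $\gamma$, the relations $\to^\infty_\gamma$ and $\rightsquigarrow_\gamma$ between derivations in $\mathcal T$ with the same conclusion are defined by the following rules: * ($\mathsf{split}$) from $s\to^* s_1'\rightsquigarrow_{\delta_1}t_1\to^* s_2'\rightsquigarrow_{\delta_2}\cdots\rightsquigarrow_{\delta_m}t_m\to^* s'$, where $m\in\mathbb N$ and $\delta_1,\dots,\delta_m<\gamma$, and from $s'\rightsquigarrow_\gamma t$, infer $s\to^\infty_\gamma t$; * ($\mathsf{lift}_{\mathsf r}$, for each $\mathsf r\in\mathcal D$ of arity $k$) from $s_i\to^\infty_\gamma s_i'$ for $1\le i\le k$, infer $\mathsf r(s_1,\dots,s_k)\rightsquigarrow_\gamma\mathsf r(s_1',\dots,s_k')$, where the $i$th premiss of this rule is coinductive if and only if $\mathrm{co}_{\mathsf r}(i)=1$. All other premisses are inductive: derivations using these rules may be non-wellfounded, provided that every infinite branch crosses infinitely many coinductive premisses (that is, one takes the greatest fixed point, in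 the coinductive premisses, of the least fixed point in the inductive ones). **Theorem.** For all $s,t\in\mathcal T$, $$s\to^\infty t\iff\text{there is an ordinal }\gamma<\omega_1\text{ with }s\to^\infty_\gamma t.$$ -/

import Mathlib

open Filter Topology
open scoped ENNReal Ordinal

universe u v w

/-- A derivation rule over a set `S` of statements: a finite arity, a partial function from
premisses to conclusion, and a marking of the premisses (`true` = coinductive, `false` = inductive). -/
structure DerivationRule (S : Type u) where
  arity : ℕ
  app : (Fin arity → S) →. S
  coind : Fin arity → Bool

section Trees

variable {S : Type u} {R : Type v}

/-- A node carries the name of a rule and a statement, and has one child per premiss of the rule. -/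
def nodeFunctor (D : R → DerivationRule S) : PFunctor.{max u v, 0} :=
  ⟨R × S, fun a => Fin (D a.1).arity⟩

/-- Arbitrary (possibly infinite) trees with nodes labelled by rules and statements,
without any correctness condition. -/
abbrev PreTree (D : R → DerivationRule S) : Type (max u v) :=
  (nodeFunctor D).M

namespace PreTree

variable {D : R → DerivationRule S}

/-- The last rule. -/
def rule (t : PreTree D) : R := t.head.1

/-- The statement at the root. -/
def concl (t : PreTree D) : S := t.head.2

/-- The `i`th immediate subtree. -/
def child (t : PreTree D) (i : Fin (D t.rule).arity) : PreTree D := t.children i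

/-- `Subtree t u`: `u` is a (not necessarily immediate or proper) subtree of `t`. -/
inductive Subtree : PreTree D → PreTree D → Prop
  | refl (t : PreTree D) : Subtree t t
  | child {t : PreTree D} (i : Fin (D t.rule).arity) {u : PreTree D}
      (h : Subtree (t.child i) u) : Subtree t u

/-- At every node, the rule is applicable to the conclusions of the immediate subtrees, and the
statement at the node is the result of applying it. -/
def LocallyCorrect (t : PreTree D) : Prop :=
  ∀ u, Subtree t u → u.concl ∈ (D u.rule).app fun i => (u.child i).concl

/-- All infinite branches cross infinitely many coinductive premisses. A branch is given by the
successive subtrees `b n` and the choices `i n` of a premiss. -/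
def Productive (t : PreTree D) : Prop :=
  ∀ (b : ℕ → PreTree D) (i : ∀ n, Fin (D (b n).rule).arity),
    b 0 = t → (∀ n, b (n + 1) = (b n).child (i n)) →
      ∃ᶠ n in atTop, (D (b n).rule).coind (i n) = true

end PreTree

/-- The set of all non-wellfounded derivation trees generated by the family `D` of rules. -/
def DTree (D : R → DerivationRule S) : Type (max u v) :=
  {t : PreTree D // t.LocallyCorrect ∧ t.Productive}

/-- The family `D` extended with a nullary rule `trunc_A` with conclusion `A` for each
statement `A`. -/
def withTrunc (D : R → DerivationRule S) : S ⊕ R → DerivationRule S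
  | Sum.inl A => ⟨0, fun _ => Part.some A, Fin.elim0⟩
  | Sum.inr r => D r

/-- One layer of the truncation at depth `d`. -/
def truncStep (D : R → DerivationRule S) :
    ℕ × PreTree D → nodeFunctor (withTrunc D) (ℕ × PreTree D)
  | (0, t) => ⟨(Sum.inl t.concl, t.concl), fun i => Fin.elim0 i⟩
  | (d + 1, t) => ⟨(Sum.inr t.rule, t.concl),
      fun i => (d + 1 - ((D t.rule).coind i).toNat, t.child i)⟩

/-- Truncation at depth `d`; see `PreTree.dest_trunc_zero` and `PreTree.dest_trunc_succ` for its
defining equations. -/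
def PreTree.trunc {D : R → DerivationRule S} (d : ℕ) (t : PreTree D) : PreTree (withTrunc D) :=
  PFunctor.M.corec (truncStep D) (d, t)

theorem PreTree.dest_trunc_zero {D : R → DerivationRule S} (t : PreTree D) :
    (t.trunc 0).dest = ⟨(Sum.inl t.concl, t.concl), fun i => Fin.elim0 i⟩ := by
  unfold PreTree.trunc
  rw [PFunctor.M.dest_corec]
  refine congrArg (Sigma.mk _) (funext fun i => ?_)
  exact Fin.elim0 i

theorem PreTree.dest_trunc_succ {D : R → DerivationRule S} (d : ℕ) (t : PreTree D) :
    (t.trunc (d + 1)).dest = ⟨(Sum.inr t.rule, t.concl),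
      fun i => (t.child i).trunc (d + 1 - ((D t.rule).coind i).toNat)⟩ := by
  unfold PreTree.trunc
  rw [PFunctor.M.dest_corec]
  rfl

namespace DTree

variable {D : R → DerivationRule S}

/-- The conclusion of a derivation tree. -/
def concl (s : DTree D) : S := s.1.concl

/-- `s.IsApp r c` means `s = r(c₁, …, c_k)`: the last rule of `s` is `r` and its immediate subtrees
are the `c i`. (As `s` is locally correct, `r` is then defined on the conclusions of the `c i`,
with value the conclusion of `s`.) -/
def IsApp (s : DTree D) (r : R) (c : Fin (D r).arity → DTree D) : Prop :=
  ∃ A : S, s.1.dest = ⟨(r, A), fun i => (c i).1⟩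

/-- The distance `inf {2⁻ᵈ | trunc d s = trunc d t}`. It is taken in `[0, ∞]`, so that it is `∞`
(and not `0`) if `s` and `t` have distinct conclusions, i.e. if no truncations coincide. -/
noncomputable def dist (s t : DTree D) : ℝ≥0∞ :=
  ⨅ (d : ℕ) (_ : s.1.trunc d = t.1.trunc d), (2⁻¹ : ℝ≥0∞) ^ d

end DTree

end Trees

section Rewriting

variable {S : Type u} {R : Type v} {D : R → DerivationRule S}

/-- `Step Z d s t`: a rewriting step at depth `d` from `s` to `t`, in the rewriting relation
generated by the set `Z` of zero steps. -/
inductive Step (Z : DTree D → DTree D → Prop) : ℕ → DTree D → DTree D → Prop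
  | zero {s t : DTree D} (h : Z s t) : Step Z 0 s t
  | context {d : ℕ} {r : R} {c : Fin (D r).arity → DTree D} (i : Fin (D r).arity)
      {u s s' : DTree D} (h : Step Z d (c i) u) (hs : s.IsApp r c)
      (hs' : s'.IsApp r (Function.update c i u)) :
      Step Z (d + ((D r).coind i).toNat) s s'

/-- The reflexive-transitive closure of the rewriting relation (of steps at any depth). -/
def Steps (Z : DTree D → DTree D → Prop) : DTree D → DTree D → Prop :=
  Relation.ReflTransGen fun s t => ∃ d, Step Z d s t

/-- A strongly converging rewriting sequence of length `γ` from `s` to `t`.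
Only the trees `term δ` for `δ ≤ γ` and the depths `depth δ` for `δ < γ` matter. -/
structure StronglyConvergingSeq (Z : DTree D → DTree D → Prop) (γ : Ordinal.{w})
    (s t : DTree D) where
  term : Ordinal.{w} → DTree D
  depth : Ordinal.{w} → ℕ
  source : term 0 = s
  target : term γ = t
  step : ∀ δ < γ, Step Z (depth δ) (term δ) (term (δ + 1))
  tendsto_term : ∀ l ≤ γ, Order.IsSuccLimit l →
    Tendsto (fun δ => (term δ).dist (term l)) (𝓝[<] l) (𝓝 0)
  tendsto_depth : ∀ l ≤ γ, Order.IsSuccLimit l → Tendsto depth (𝓝[<] l) atTop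

/-- Infinitary rewriting: there is a strongly converging rewriting sequence, of any ordinal length,
from `s` to `t`. -/
def InfRed (Z : DTree D → DTree D → Prop) (s t : DTree D) : Prop :=
  ∃ γ : Ordinal.{w}, Nonempty (StronglyConvergingSeq Z γ s t)

/-! The rules `split` and `lift_r`. The coinductive premisses are read in a given family `X` of
relations, the other ones inductively. -/

mutual

/-- Conclusions of the rule `split`. -/
inductive SplitRule (Z : DTree D → DTree D → Prop) (X : Ordinal.{w} → DTree D → DTree D → Prop) :
    Ordinal.{w} → DTree D → DTree D → Prop
  | split {γ : Ordinal.{w}} {m : ℕ} {s s' t : DTree D} (h : InterleavedSeq Z X γ m s s')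
      (h' : LiftRule Z X γ s' t) : SplitRule Z X γ s t

/-- Conclusions of the rules `lift_r`; they relate derivations of the same statement. -/
inductive LiftRule (Z : DTree D → DTree D → Prop) (X : Ordinal.{w} → DTree D → DTree D → Prop) :
    Ordinal.{w} → DTree D → DTree D → Prop
  | lift {γ : Ordinal.{w}} (r : R) {c c' : Fin (D r).arity → DTree D} {s t : DTree D}
      (hs : s.IsApp r c) (ht : t.IsApp r c') (hst : s.concl = t.concl)
      (hcoind : ∀ i, (D r).coind i = true → X γ (c i) (c' i))
      (hind : ∀ i, (D r).coind i = false → SplitRule Z X γ (c i) (c' i)) :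
      LiftRule Z X γ s t

/-- Finite sequences `s ⟶* s₁ ⇝[δ₁] t₁ ⟶* s₂ ⇝[δ₂] ⋯ ⇝[δₘ] tₘ ⟶* s'` with all `δᵢ < γ`,
where `⇝[δ]` is the relation concluded by the rules `lift_r`. -/
inductive InterleavedSeq (Z : DTree D → DTree D → Prop)
    (X : Ordinal.{w} → DTree D → DTree D → Prop) :
    Ordinal.{w} → ℕ → DTree D → DTree D → Prop
  | nil {γ : Ordinal.{w}} {s s' : DTree D} (h : Steps Z s s') : InterleavedSeq Z X γ 0 s s'
  | cons {γ δ : Ordinal.{w}} {m : ℕ} {s s₁ t₁ s' : DTree D} (h : Steps Z s s₁) (hδ : δ < γ)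
      (h₁ : LiftRule Z X δ s₁ t₁) (h' : InterleavedSeq Z X γ m t₁ s') :
      InterleavedSeq Z X γ (m + 1) s s'

end

/-- The relation `⟶∞[γ]` defined by the mixed inductive and coinductive rules `split` and `lift_r`:
the greatest fixed point, in the coinductive premisses, of the least fixed point, in the inductive
ones. (Equivalently, derivability by a non-wellfounded derivation whose infinite branches all cross
infinitely many coinductive premisses.) -/
def CoindRed (Z : DTree D → DTree D → Prop) (γ : Ordinal.{w}) (s t : DTree D) : Prop :=
  ∃ X : Ordinal.{w} → DTree D → DTree D → Prop,
    (∀ δ s' t', X δ s' t' → SplitRule Z X δ s' t') ∧ X γ s t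

end Rewriting

/-!
In a strongly converging sequence only finitely many steps have depth less than a given `k`, since
the depths tend to infinity at every limit; hence its length is countable. After the last step at
depth `0` the sequence acts on the immediate subtrees independently, which is an application of
`lift`, with sequences of the same length in the subtrees. Each earlier step at depth `0` is
preceded by a shorter sequence, which is treated by induction. The relations given by strongly
converging sequences of length at most `γ` are thus closed backwards under `split` and `lift`.
Recursion into inductive premisses is well-founded, as no infinite branch of a derivation consists
of such premisses only.

Conversely, unfolding a derivation of `s ⟶∞[γ] t` down to depth `k` rewrites `s` to a tree which
agrees with `t` up to depth `k`, by induction on `γ` and on inductive premisses; each further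
unfolding only adds steps at depth at least `k`. The concatenation of these `ω` many sequences
therefore converges strongly, with limit `t`.
-/

section Trees

variable {S : Type u} {R : Type v} {D : R → DerivationRule S}

namespace PreTree

theorem locallyCorrect_iff {t : PreTree D} :
    t.LocallyCorrect ↔
      t.concl ∈ (D t.rule).app (fun i => (t.child i).concl) ∧
        ∀ i, (t.child i).LocallyCorrect := by
  refine ⟨fun h => ⟨h t (.refl t), fun i u hu => h u (.child i hu)⟩, ?_⟩
  rintro ⟨ht, hchild⟩ u (_ | ⟨i, hu⟩)
  exacts [ht, hchild i u hu]

theorem productive_iff {t : PreTree D} : t.Productive ↔ ∀ i, (t.child i).Productive := by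
  constructor
  · intro h i b j hb hj
    let b' : ℕ → PreTree D := fun n => Nat.casesOn n t b
    let j' : ∀ n, Fin (D (b' n).rule).arity := fun n =>
      Nat.casesOn (motive := fun n => Fin (D (b' n).rule).arity) n i j
    have hfreq := h b' j' rfl (by rintro (_ | n); exacts [hb, hj n])
    rwa [← map_add_atTop_eq_nat 1, frequently_map] at hfreq
  · rintro h b j rfl hj
    rw [← map_add_atTop_eq_nat 1, frequently_map]
    exact h (j 0) (fun n => b (n + 1)) (fun n => j (n + 1)) (hj 0) fun n => hj (n + 1)

theorem dest_injective : Function.Injective (PFunctor.M.dest : PreTree D → _) :=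
  Function.LeftInverse.injective PFunctor.M.mk_dest

theorem concl_trunc (n : ℕ) (t : PreTree D) : (t.trunc n).concl = t.concl := by
  cases n with
  | zero => exact congrArg (fun y => y.1.2) t.dest_trunc_zero
  | succ n => exact congrArg (fun y => y.1.2) (t.dest_trunc_succ n)

end PreTree

namespace DTree

/-! ### The last rule of a derivation -/

/-- The immediate subtrees of a derivation tree, as derivation trees. -/
def sub (s : DTree D) (i : Fin (D s.1.rule).arity) : DTree D :=
  ⟨s.1.child i, (PreTree.locallyCorrect_iff.1 s.2.1).2 i, PreTree.productive_iff.1 s.2.2 i⟩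

theorem isApp_sub (s : DTree D) : s.IsApp s.1.rule s.sub :=
  ⟨s.1.concl, rfl⟩

theorem exists_isApp (s : DTree D) : ∃ r c, s.IsApp r c :=
  ⟨s.1.rule, s.sub, s.isApp_sub⟩

section IsApp

variable {s t : DTree D} {r : R} {c c' : Fin (D r).arity → DTree D}

theorem IsApp.dest_eq (h : s.IsApp r c) : s.1.dest = ⟨(r, s.concl), fun i => (c i).1⟩ := by
  obtain ⟨A, hA⟩ := h
  obtain rfl : s.concl = A := congrArg (fun y => y.1.2) hA
  exact hA

theorem IsApp.rule_eq {r' : R} {c' : Fin (D r').arity → DTree D} (h : s.IsApp r c)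
    (h' : s.IsApp r' c') : r = r' :=
  congrArg (fun y => y.1.1) (h.dest_eq.symm.trans h'.dest_eq)

theorem IsApp.children_eq (h : s.IsApp r c) (h' : s.IsApp r c') : c = c' := by
  have hcc' := eq_of_heq (Sigma.mk.inj (h.dest_eq.symm.trans h'.dest_eq)).2
  exact funext fun i => Subtype.ext (congrFun hcc' i)

theorem IsApp.dest_trunc_succ (h : s.IsApp r c) (n : ℕ) :
    (s.1.trunc (n + 1)).dest =
      ⟨(Sum.inr r, s.concl), fun i => (c i).1.trunc (n + 1 - ((D r).coind i).toNat)⟩ := by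
  obtain rfl := h.rule_eq s.isApp_sub
  obtain rfl := h.children_eq s.isApp_sub
  exact s.1.dest_trunc_succ n

theorem IsApp.concl_mem (h : s.IsApp r c) : s.concl ∈ (D r).app fun i => (c i).concl := by
  obtain rfl := h.rule_eq s.isApp_sub
  obtain rfl := h.children_eq s.isApp_sub
  exact (PreTree.locallyCorrect_iff.1 s.2.1).1

theorem IsApp.concl_eq (h : s.IsApp r c) (h' : t.IsApp r c')
    (hc : ∀ i, (c i).concl = (c' i).concl) : s.concl = t.concl :=
  Part.mem_unique h.concl_mem (funext hc ▸ h'.concl_mem)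

theorem IsApp.unique (h : s.IsApp r c) (h' : t.IsApp r c) : s = t := by
  apply Subtype.ext
  apply PreTree.dest_injective
  rw [h.dest_eq, h'.dest_eq, h.concl_eq h' fun _ => rfl]

theorem IsApp.exists_replace (h : s.IsApp r c) (hc : ∀ i, (c i).concl = (c' i).concl) :
    ∃ t : DTree D, t.IsApp r c' := by
  have hmem : s.concl ∈ (D r).app fun i => (c' i).concl := funext hc ▸ h.concl_mem
  let y : nodeFunctor D (PreTree D) := ⟨(r, s.concl), fun i => (c' i).1⟩
  refine ⟨⟨PFunctor.M.mk y, ?_, ?_⟩, s.concl, PFunctor.M.dest_mk y⟩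
  · exact PreTree.locallyCorrect_iff.2 ⟨hmem, fun i => (c' i).2.1⟩
  · exact PreTree.productive_iff.2 fun i => (c' i).2.2

end IsApp

theorem inductive_premiss_induction {P : DTree D → Prop}
    (H : ∀ s r c, s.IsApp r c → (∀ i, (D r).coind i = false → P (c i)) → P s) (s : DTree D) :
    P s := by
  by_contra hs
  have exists_bad_premiss : ∀ x : {x : DTree D // ¬P x}, ∃ i : Fin (D x.1.1.rule).arity,
      (D x.1.1.rule).coind i = false ∧ ¬P (x.1.sub i) := by
    intro x
    by_contra! hx
    exact x.2 (H _ _ _ x.1.isApp_sub hx)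
  choose j hj hP using exists_bad_premiss
  let b : ℕ → {x : DTree D // ¬P x} := fun n =>
    Nat.rec ⟨s, hs⟩ (fun _ x => ⟨x.1.sub (j x), hP x⟩) n
  have hfreq := s.2.2 (fun n => (b n).1.1) (fun n => j (b n)) rfl fun n => rfl
  obtain ⟨n, hn⟩ := hfreq.exists
  simp [hj] at hn

/-- A relation between derivations all of whose instances have the same conclusion on both
sides. -/
def PreservesConcl (X : DTree D → DTree D → Prop) : Prop :=
  ∀ s t, X s t → s.concl = t.concl

/-! ### Agreement of truncations -/

/-- `s` and `t` have the same truncation at depth `n`. These relations form the uniformity of the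
ultrametric `DTree.dist`. -/
def AgreeTo (n : ℕ) (s t : DTree D) : Prop := s.1.trunc n = t.1.trunc n

section AgreeTo

variable {m n : ℕ} {s t p : DTree D}

theorem AgreeTo.refl (n : ℕ) (s : DTree D) : AgreeTo n s s := rfl

theorem AgreeTo.symm (h : AgreeTo n s t) : AgreeTo n t s := Eq.symm h

theorem AgreeTo.trans (h : AgreeTo n s t) (h' : AgreeTo n t p) : AgreeTo n s p := Eq.trans h h'

theorem AgreeTo.concl_eq (h : AgreeTo n s t) : s.concl = t.concl := by
  rw [concl, ← PreTree.concl_trunc n, h, PreTree.concl_trunc n, concl]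

theorem agreeTo_zero : AgreeTo 0 s t ↔ s.concl = t.concl := by
  refine ⟨AgreeTo.concl_eq, fun h => PreTree.dest_injective ?_⟩
  have hst : s.1.concl = t.1.concl := h
  rw [PreTree.dest_trunc_zero, PreTree.dest_trunc_zero, hst]

section IsApp

variable {r : R} {c c' : Fin (D r).arity → DTree D}

theorem IsApp.agreeTo_succ_iff (h : s.IsApp r c) (h' : t.IsApp r c') :
    AgreeTo (n + 1) s t ↔ ∀ i, AgreeTo (n + 1 - ((D r).coind i).toNat) (c i) (c' i) := by
  rw [AgreeTo, ← PreTree.dest_injective.eq_iff, h.dest_trunc_succ, h'.dest_trunc_succ]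
  constructor
  · intro hdest
    exact congrFun (eq_of_heq (Sigma.mk.inj hdest).2)
  · intro hc
    rw [h.concl_eq h' fun i => (hc i).concl_eq]
    exact congrArg (Sigma.mk _) (funext hc)

theorem IsApp.agreeTo (h : s.IsApp r c) (h' : t.IsApp r c')
    (hc : ∀ i, AgreeTo (n - ((D r).coind i).toNat) (c i) (c' i)) : AgreeTo n s t := by
  cases n with
  | zero => exact agreeTo_zero.2 (h.concl_eq h' fun i => (hc i).concl_eq)
  | succ n => exact (h.agreeTo_succ_iff h').2 hc

theorem IsApp.exists_of_agreeTo_succ (h : s.IsApp r c) (hst : AgreeTo (n + 1) s t) :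
    ∃ c', t.IsApp r c' := by
  obtain ⟨r', c', h'⟩ := t.exists_isApp
  have hdest := congrArg PFunctor.M.dest hst
  rw [h.dest_trunc_succ, h'.dest_trunc_succ] at hdest
  obtain rfl : r = r' := Sum.inr.inj (congrArg (fun y => y.1.1) hdest)
  exact ⟨c', h'⟩

end IsApp

theorem AgreeTo.pred (h : AgreeTo (n + 1) s t) : AgreeTo n s t := by
  induction n generalizing s t with
  | zero => exact agreeTo_zero.2 h.concl_eq
  | succ n ihn =>
    induction s using inductive_premiss_induction generalizing t with
    | H s r c hc ih =>
      obtain ⟨c', hc'⟩ := hc.exists_of_agreeTo_succ h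
      rw [hc.agreeTo_succ_iff hc'] at h ⊢
      intro i
      have hi := h i
      cases hco : (D r).coind i with
      | false =>
        rw [hco] at hi
        exact ih i hco hi
      | true =>
        rw [hco] at hi
        exact ihn hi

theorem AgreeTo.mono (hmn : m ≤ n) (h : AgreeTo n s t) : AgreeTo m s t := by
  induction hmn with
  | refl => exact h
  | step _ ih => exact ih h.pred

theorem eq_of_forall_agreeTo (h : ∀ n, AgreeTo n s t) : s = t := by
  apply Subtype.ext
  refine PFunctor.M.bisim
    (fun x y => ∃ s t : DTree D, x = s.1 ∧ y = t.1 ∧ ∀ n, AgreeTo n s t) ?_ s.1 t.1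
    ⟨s, t, rfl, rfl, h⟩
  rintro _ _ ⟨s, t, rfl, rfl, h⟩
  obtain ⟨r, c, hc⟩ := s.exists_isApp
  obtain ⟨c', hc'⟩ := hc.exists_of_agreeTo_succ (h 1)
  refine ⟨_, _, _, hc.dest_eq, (h 0).concl_eq ▸ hc'.dest_eq, fun i => ⟨c i, c' i, rfl, rfl, ?_⟩⟩
  intro n
  exact ((hc.agreeTo_succ_iff hc').1 (h (n + 1)) i).mono (by cases (D r).coind i <;> simp)

theorem AgreeTo.dist_le (h : AgreeTo n s t) : s.dist t ≤ (2⁻¹ : ℝ≥0∞) ^ n :=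
  iInf₂_le n h

theorem agreeTo_of_dist_lt (h : s.dist t < (2⁻¹ : ℝ≥0∞) ^ n) : AgreeTo n s t := by
  simp only [dist, iInf_lt_iff] at h
  obtain ⟨k, hk, hlt⟩ := h
  have hnk : n < k := lt_of_not_ge fun hkn =>
    hlt.not_ge (pow_le_pow_right_of_le_one' (ENNReal.inv_le_one.2 one_le_two) hkn)
  exact AgreeTo.mono hnk.le hk

theorem tendsto_dist_iff {α : Type*} {L : Filter α} {f : α → DTree D} :
    Tendsto (fun x => (f x).dist t) L (𝓝 0) ↔ ∀ n, ∀ᶠ x in L, AgreeTo n (f x) t := by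
  constructor
  · intro h n
    have hpos : (0 : ℝ≥0∞) < 2⁻¹ ^ n :=
      ENNReal.pow_pos (ENNReal.inv_pos.2 ENNReal.ofNat_ne_top) n
    filter_upwards [h.eventually_lt_const hpos] with x hx
    exact agreeTo_of_dist_lt hx
  · intro h
    rw [ENNReal.tendsto_nhds_zero]
    intro ε hε
    obtain ⟨n, hn⟩ := ENNReal.exists_inv_two_pow_lt hε.ne'
    filter_upwards [h n] with x hx
    exact hx.dist_le.trans hn.le

end AgreeTo

end DTree

end Trees

section Runs

variable {S : Type u} {R : Type v} {D : R → DerivationRule S} {Z : DTree D → DTree D → Prop}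

open Set DTree

theorem Step.agreeTo (hZ : PreservesConcl Z) {d : ℕ} {s t : DTree D} (h : Step Z d s t) :
    AgreeTo d s t := by
  induction h with
  | zero h => exact agreeTo_zero.2 (hZ _ _ h)
  | @context d r c i u s s' h hs hs' ih =>
    refine hs.agreeTo hs' fun j => ?_
    obtain rfl | hij := eq_or_ne j i
    · simpa only [Nat.add_sub_cancel_right, Function.update_self] using ih
    · simpa only [Function.update_of_ne hij] using AgreeTo.refl _ _

theorem Steps.concl_eq (hZ : PreservesConcl Z) {s t : DTree D} (h : Steps Z s t) :
    s.concl = t.concl := by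
  induction h with
  | refl => rfl
  | tail _ h ih =>
    obtain ⟨d, h⟩ := h
    exact ih.trans (h.agreeTo hZ).concl_eq

/-! ### Strongly converging sequences on intervals -/

theorem nhdsLT_neBot_of_isSuccLimit {α : Type*} [TopologicalSpace α] [LinearOrder α]
    [OrderTopology α] {l : α} (hl : Order.IsSuccLimit l) : (𝓝[<] l).NeBot :=
  hl.isLUB_Iio.nhdsWithin_neBot (Iio_nonempty.2 hl.not_isMin)

theorem transfinite_induction_Icc {a b : Ordinal.{w}} {p : Ordinal.{w} → Prop} (base : p a)
    (succ : ∀ δ ∈ Ico a b, p δ → p (δ + 1))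
    (limit : ∀ l ∈ Ioc a b, Order.IsSuccLimit l → (∀ δ ∈ Ico a l, p δ) → p l) :
    ∀ δ ∈ Icc a b, p δ := by
  rintro δ ⟨haδ, hδb⟩
  induction δ using Ordinal.limitRecOn with
  | zero => rwa [← nonpos_iff_eq_zero.1 haδ]
  | add_one δ ih =>
    obtain rfl | haδ := haδ.eq_or_lt
    · exact base
    · rw [Order.lt_add_one_iff] at haδ
      rw [Order.add_one_le_iff] at hδb
      exact succ δ ⟨haδ, hδb⟩ (ih haδ hδb.le)
  | limit l hl ih =>
    obtain rfl | hal := haδ.eq_or_lt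
    · exact base
    · exact limit l ⟨hal, hδb⟩ hl fun δ hδ => ih δ hδ.2 hδ.1 (hδ.2.le.trans hδb)

/-- The trees `f δ` for `δ ∈ [a, b]` form a strongly converging sequence, whose step from `f δ` to
`f (δ + 1)` belongs to `P (d δ)` and has depth `d δ ≥ n`. As with `StronglyConvergingSeq`, other
values of `f` and `d` do not matter. -/
structure IsRun (P : ℕ → DTree D → DTree D → Prop) (n : ℕ) (a b : Ordinal.{w})
    (f : Ordinal.{w} → DTree D) (d : Ordinal.{w} → ℕ) : Prop where
  step : ∀ δ ∈ Ico a b, P (d δ) (f δ) (f (δ + 1))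
  le_depth : ∀ δ ∈ Ico a b, n ≤ d δ
  eventually_agreeTo : ∀ l ∈ Ioc a b, Order.IsSuccLimit l →
    ∀ k, ∀ᶠ δ in 𝓝[<] l, AgreeTo k (f δ) (f l)
  tendsto_depth : ∀ l ∈ Ioc a b, Order.IsSuccLimit l → Tendsto d (𝓝[<] l) atTop

namespace IsRun

variable {P : ℕ → DTree D → DTree D → Prop} {n : ℕ} {a b : Ordinal.{w}}
  {f : Ordinal.{w} → DTree D} {d : Ordinal.{w} → ℕ}

theorem mono {a' b' : Ordinal.{w}} (h : IsRun P n a b f d) (ha : a ≤ a') (hb : b' ≤ b) :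
    IsRun P n a' b' f d where
  step δ hδ := h.step δ (Ico_subset_Ico ha hb hδ)
  le_depth δ hδ := h.le_depth δ (Ico_subset_Ico ha hb hδ)
  eventually_agreeTo l hl := h.eventually_agreeTo l (Ioc_subset_Ioc ha hb hl)
  tendsto_depth l hl := h.tendsto_depth l (Ioc_subset_Ioc ha hb hl)

theorem of_le_depth {m : ℕ} (h : IsRun P n a b f d) (hm : ∀ δ ∈ Ico a b, m ≤ d δ) :
    IsRun P m a b f d :=
  { h with le_depth := hm }

theorem congr {f' : Ordinal.{w} → DTree D} {d' : Ordinal.{w} → ℕ} (h : IsRun P n a b f d)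
    (hf : EqOn f' f (Icc a b)) (hd : EqOn d' d (Ico a b)) : IsRun P n a b f' d' where
  step δ hδ := by
    have hδ' : δ + 1 ∈ Icc a b := ⟨hδ.1.trans (Order.le_succ δ), Order.add_one_le_of_lt hδ.2⟩
    rw [hd hδ, hf ⟨hδ.1, hδ.2.le⟩, hf hδ']
    exact h.step δ hδ
  le_depth δ hδ := (hd hδ).symm ▸ h.le_depth δ hδ
  eventually_agreeTo l hl hlim k := by
    rw [hf (Ioc_subset_Icc_self hl)]
    filter_upwards [h.eventually_agreeTo l hl hlim k, Ico_mem_nhdsLT hl.1] with δ hk hδ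
    rwa [hf ⟨hδ.1, hδ.2.le.trans hl.2⟩]
  tendsto_depth l hl hlim := by
    refine (h.tendsto_depth l hl hlim).congr' ?_
    filter_upwards [Ico_mem_nhdsLT hl.1] with δ hδ
    exact (hd ⟨hδ.1, hδ.2.trans_le hl.2⟩).symm

theorem append {c : Ordinal.{w}} (h : IsRun P n a b f d) (h' : IsRun P n b c f d) :
    IsRun P n a c f d where
  step δ hδ := (lt_or_ge δ b).elim (fun hb => h.step δ ⟨hδ.1, hb⟩) fun hb => h'.step δ ⟨hb, hδ.2⟩
  le_depth δ hδ :=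
    (lt_or_ge δ b).elim (fun hb => h.le_depth δ ⟨hδ.1, hb⟩) fun hb => h'.le_depth δ ⟨hb, hδ.2⟩
  eventually_agreeTo l hl := (le_or_gt l b).elim (fun hb => h.eventually_agreeTo l ⟨hl.1, hb⟩)
    fun hb => h'.eventually_agreeTo l ⟨hb, hl.2⟩
  tendsto_depth l hl := (le_or_gt l b).elim (fun hb => h.tendsto_depth l ⟨hl.1, hb⟩)
    fun hb => h'.tendsto_depth l ⟨hb, hl.2⟩

theorem agreeTo (hP : ∀ d s t, P d s t → AgreeTo d s t) (h : IsRun P n a b f d) :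
    ∀ δ ∈ Icc a b, AgreeTo n (f a) (f δ) := by
  refine transfinite_induction_Icc (.refl _ _) (fun δ hδ ih => ?_) fun l hl hlim ih => ?_
  · exact ih.trans ((hP _ _ _ (h.step δ hδ)).mono (h.le_depth δ hδ))
  · have := nhdsLT_neBot_of_isSuccLimit hlim
    obtain ⟨δ, hδl, hδ⟩ :=
      ((h.eventually_agreeTo l hl hlim n).and (Ico_mem_nhdsLT hl.1)).exists
    exact (ih δ hδ).trans hδl

theorem finite_depth_lt (h : IsRun P n a b f d) (k : ℕ) :
    ∀ δ ∈ Icc a b, {ε ∈ Ico a δ | d ε < k}.Finite := by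
  refine transfinite_induction_Icc (by simp) (fun δ _ ih => ?_) fun l hl hlim ih => ?_
  · refine (ih.insert δ).subset ?_
    rintro ε ⟨⟨haε, hεδ⟩, hε⟩
    exact (Order.lt_add_one_iff.1 hεδ).eq_or_lt.imp id fun hεδ => ⟨⟨haε, hεδ⟩, hε⟩
  · have hdepth := (h.tendsto_depth l hl hlim).eventually_ge_atTop k
    rw [(nhdsLT_basis_of_exists_lt ⟨a, hl.1⟩).eventually_iff] at hdepth
    obtain ⟨β, hβl, hβ⟩ := hdepth
    have hmax : max a (β + 1) < l := max_lt hl.1 (hlim.add_one_lt hβl)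
    refine (ih _ ⟨le_max_left _ _, hmax⟩).subset ?_
    rintro ε ⟨⟨haε, hεl⟩, hε⟩
    have hεβ : ε ≤ β := not_lt.1 fun hβε => hε.not_ge (hβ ⟨hβε, hεl⟩)
    exact ⟨⟨haε, lt_max_of_lt_right (Order.lt_add_one_iff.2 hεβ)⟩, hε⟩

theorem lt_omega_one (h : IsRun P n 0 b f d) : b < ω₁ := by
  have hcountable : (Iio b).Countable := by
    have hdepth k := (h.finite_depth_lt k b ⟨zero_le, le_rfl⟩).countable
    refine (countable_iUnion hdepth).mono fun ε hε => ?_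
    exact mem_iUnion.2 ⟨d ε + 1, ⟨zero_le, hε⟩, Nat.lt_succ_self _⟩
  rw [← Cardinal.le_aleph0_iff_set_countable, Cardinal.mk_Iio_ordinal,
    Cardinal.lift_le_aleph0] at hcountable
  rwa [← Cardinal.ord_aleph, Cardinal.lt_ord, ← Cardinal.succ_aleph0, Order.lt_succ_iff]

end IsRun

theorem nonempty_stronglyConvergingSeq_iff {γ : Ordinal.{w}} {s t : DTree D} :
    Nonempty (StronglyConvergingSeq Z γ s t) ↔
      ∃ f d, IsRun (Step Z) 0 0 γ f d ∧ f 0 = s ∧ f γ = t := by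
  constructor
  · rintro ⟨q⟩
    refine ⟨q.term, q.depth, ?_, q.source, q.target⟩
    exact
      { step := fun δ hδ => q.step δ hδ.2
        le_depth := fun _ _ => Nat.zero_le _
        eventually_agreeTo := fun l hl hlim => tendsto_dist_iff.1 (q.tendsto_term l hl.2 hlim)
        tendsto_depth := fun l hl => q.tendsto_depth l hl.2 }
  · rintro ⟨f, d, h, hs, ht⟩
    exact
      ⟨{ term := f
         depth := d
         source := hs
         target := ht
         step := fun δ hδ => h.step δ ⟨zero_le, hδ⟩
         tendsto_term := fun l hl hlim =>
           tendsto_dist_iff.2 (h.eventually_agreeTo l ⟨hlim.bot_lt, hl⟩ hlim)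
         tendsto_depth := fun l hl hlim => h.tendsto_depth l ⟨hlim.bot_lt, hl⟩ hlim }⟩

end Runs

section Decomposition

variable {S : Type u} {R : Type v} {D : R → DerivationRule S} {Z : DTree D → DTree D → Prop}

open Set DTree

/-! ### From strongly converging sequences to derivations -/

/-- A step at depth `d`, or no change at all. A run of steps in a tree induces runs of lazy steps
of the same length in all subtrees. -/
def LazyStep (Z : DTree D → DTree D → Prop) (d : ℕ) (s t : DTree D) : Prop :=
  s = t ∨ Step Z d s t

theorem LazyStep.agreeTo (hZ : PreservesConcl Z) (d : ℕ) (s t : DTree D) (h : LazyStep Z d s t) :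
    AgreeTo d s t := by
  rcases h with rfl | h
  exacts [.refl _ _, h.agreeTo hZ]

theorem LazyStep.steps {d : ℕ} {s t : DTree D} (h : LazyStep Z d s t) : Steps Z s t := by
  rcases h with rfl | h
  exacts [.refl, .single ⟨d, h⟩]

theorem LazyStep.children {d : ℕ} {s t : DTree D} {r : R} {c c' : Fin (D r).arity → DTree D}
    (h : LazyStep Z d s t) (hd : 1 ≤ d) (hs : s.IsApp r c) (ht : t.IsApp r c')
    (i : Fin (D r).arity) : LazyStep Z (d - ((D r).coind i).toNat) (c i) (c' i) := by
  rcases h with rfl | h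
  · exact .inl (congrFun (hs.children_eq ht) i)
  cases h with
  | zero => omega
  | @context d r₀ c₀ j u _ _ h hs₀ ht₀ =>
    obtain rfl := hs₀.rule_eq hs
    obtain rfl := hs₀.children_eq hs
    obtain rfl := ht₀.children_eq ht
    obtain rfl | hij := eq_or_ne i j
    · rw [Nat.add_sub_cancel, Function.update_self]
      exact .inr h
    · exact .inl (Function.update_of_ne hij _ _).symm

section

variable {a b : Ordinal.{w}} {f : Ordinal.{w} → DTree D} {d : Ordinal.{w} → ℕ}

theorem IsRun.children (hZ : PreservesConcl Z) (h : IsRun (LazyStep Z) 1 a b f d) {r : R}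
    {c : Fin (D r).arity → DTree D} (hc : (f a).IsApp r c) :
    ∃ g : Ordinal.{w} → Fin (D r).arity → DTree D,
      (∀ δ ∈ Icc a b, (f δ).IsApp r (g δ)) ∧
      ∀ i, IsRun (LazyStep Z) (1 - ((D r).coind i).toNat) a b (fun δ => g δ i)
        (fun δ => d δ - ((D r).coind i).toNat) := by
  have : Nonempty (Fin (D r).arity → DTree D) := ⟨c⟩
  have exists_children : ∀ δ ∈ Icc a b, ∃ c', (f δ).IsApp r c' := fun δ hδ =>
    hc.exists_of_agreeTo_succ (h.agreeTo (LazyStep.agreeTo hZ) δ hδ)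
  choose! g hg using exists_children
  refine ⟨g, hg, fun i => ?_⟩
  have hco : ((D r).coind i).toNat ≤ 1 := Bool.toNat_le _
  constructor
  · intro δ hδ
    have hδ' : δ + 1 ∈ Icc a b := ⟨hδ.1.trans (Order.le_succ δ), Order.add_one_le_of_lt hδ.2⟩
    exact (h.step δ hδ).children (h.le_depth δ hδ) (hg δ ⟨hδ.1, hδ.2.le⟩) (hg (δ + 1) hδ') i
  · exact fun δ hδ => Nat.sub_le_sub_right (h.le_depth δ hδ) _
  · intro l hl hlim k
    filter_upwards [h.eventually_agreeTo l hl hlim (k + 1), Ico_mem_nhdsLT hl.1] with δ hagree hδ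
    have hgδ := hg δ ⟨hδ.1, hδ.2.le.trans hl.2⟩
    exact ((hgδ.agreeTo_succ_iff (hg l ⟨hl.1.le, hl.2⟩)).1 hagree i).mono (by omega)
  · exact fun l hl hlim => (tendsto_sub_atTop_nat _).comp (h.tendsto_depth l hl hlim)

/-- `s` and `t` are connected by a lazy run that ends not after `γ`. This family of relations
is closed backwards under the rules `split` and `lift`. -/
def LazyRed (Z : DTree D → DTree D → Prop) (γ : Ordinal.{w}) (s t : DTree D) : Prop :=
  ∃ a b f d, a ≤ b ∧ b ≤ γ ∧ IsRun (LazyStep Z) 0 a b f d ∧ f a = s ∧ f b = t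

theorem IsRun.liftRule (hZ : PreservesConcl Z) {γ : Ordinal.{w}} (hab : a ≤ b) (hb : b ≤ γ)
    (h : IsRun (LazyStep Z) 1 a b f d) : LiftRule Z (LazyRed Z) γ (f a) (f b) := by
  generalize hs : f a = s
  induction s using inductive_premiss_induction generalizing f d with
  | H s r c hc ih =>
    subst hs
    obtain ⟨g, hg, hrun⟩ := h.children hZ hc
    obtain rfl := hc.children_eq (hg a ⟨le_rfl, hab⟩)
    have hconcl := (h.agreeTo (LazyStep.agreeTo hZ) b ⟨hab, le_rfl⟩).concl_eq
    refine .lift r hc (hg b ⟨hab, le_rfl⟩) hconcl (fun i _ => ?_) fun i hi => ?_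
    · exact ⟨a, b, _, _, hab, hb, (hrun i).of_le_depth fun _ _ => Nat.zero_le _, rfl, rfl⟩
    · have hrun_i := hrun i
      rw [hi] at hrun_i
      exact .split (.nil .refl) (ih i hi hrun_i rfl)

theorem InterleavedSeq.append {X : Ordinal.{w} → DTree D → DTree D → Prop} {γ δ : Ordinal.{w}}
    {m : ℕ} {s s₁ t₁ t : DTree D} (h : InterleavedSeq Z X γ m s s₁) (hδ : δ < γ)
    (h₁ : LiftRule Z X δ s₁ t₁) (h' : Steps Z t₁ t) : InterleavedSeq Z X γ (m + 1) s t := by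
  induction m generalizing s with
  | zero =>
    cases h with
    | nil h => exact .cons h hδ h₁ (.nil h')
  | succ m ih =>
    cases h with
    | cons h₂ hδ' h₃ h₄ => exact .cons h₂ hδ' h₃ (ih h₄)

theorem IsRun.exists_interleavedSeq (hZ : PreservesConcl Z) {γ : Ordinal.{w}} (hab : a ≤ b)
    (hb : b ≤ γ) (h : IsRun (LazyStep Z) 0 a b f d) :
    ∃ β ∈ Icc a b, ∃ m, InterleavedSeq Z (LazyRed Z) γ m (f a) (f β) ∧
      IsRun (LazyStep Z) 1 β b f d := by
  induction b using WellFoundedLT.induction with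
  | _ b ih =>
  obtain hempty | hne := {ε ∈ Ico a b | d ε < 1}.eq_empty_or_nonempty
  · refine ⟨a, ⟨le_rfl, hab⟩, 0, .nil .refl, h.of_le_depth fun δ hδ => ?_⟩
    exact not_lt.1 fun hlt => eq_empty_iff_forall_notMem.1 hempty δ ⟨hδ, hlt⟩
  · obtain ⟨ε, ⟨⟨haε, hεb⟩, -⟩, hlast⟩ :=
      exists_max_image _ id (h.finite_depth_lt 1 b ⟨hab, le_rfl⟩) hne
    obtain ⟨β, hβ, m, hseq, hrun⟩ := ih ε hεb haε (hεb.le.trans hb) (h.mono le_rfl hεb.le)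
    have hε : ε + 1 ∈ Icc a b := ⟨haε.trans (Order.le_succ ε), Order.add_one_le_of_lt hεb⟩
    refine ⟨ε + 1, hε, m + 1, ?_, (h.mono hε.1 le_rfl).of_le_depth fun δ hδ => ?_⟩
    · exact hseq.append (hεb.trans_le hb) (hrun.liftRule hZ hβ.2 le_rfl) (h.step ε ⟨haε, hεb⟩).steps
    · refine not_lt.1 fun hlt => (Order.add_one_le_iff.1 hδ.1).not_ge ?_
      exact hlast δ ⟨⟨hε.1.trans hδ.1, hδ.2⟩, hlt⟩

end

theorem LazyRed.splitRule (hZ : PreservesConcl Z) {γ : Ordinal.{w}} {s t : DTree D}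
    (h : LazyRed Z γ s t) : SplitRule Z (LazyRed Z) γ s t := by
  obtain ⟨a, b, f, d, hab, hb, h, rfl, rfl⟩ := h
  obtain ⟨β, hβ, m, hseq, hrun⟩ := h.exists_interleavedSeq hZ hab hb
  exact .split hseq (hrun.liftRule hZ hβ.2 hb)

theorem LazyRed.coindRed (hZ : PreservesConcl Z) {γ : Ordinal.{w}} {s t : DTree D}
    (h : LazyRed Z γ s t) : CoindRed Z γ s t :=
  ⟨LazyRed Z, fun _ _ _ => splitRule hZ, h⟩

theorem IsRun.lazyRed {γ : Ordinal.{w}} {f : Ordinal.{w} → DTree D} {d : Ordinal.{w} → ℕ}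
    (h : IsRun (Step Z) 0 0 γ f d) : LazyRed Z γ (f 0) (f γ) :=
  ⟨0, γ, f, d, zero_le, le_rfl, { h with step := fun δ hδ => .inr (h.step δ hδ) }, rfl, rfl⟩

end Decomposition

section Composition

variable {S : Type u} {R : Type v} {D : R → DerivationRule S} {Z : DTree D → DTree D → Prop}

open Set DTree

/-! ### Infinitary reductions as a closure under composition and limits -/

/-- Infinitary reductions all of whose steps have depth at least `n`, generated from the steps by
composition and by composition of sequences in which the depth tends to infinity. Unlike runs,
they mention no ordinals; see `DeepRed.exists_isRun`. -/
inductive DeepRed (Z : DTree D → DTree D → Prop) : ℕ → DTree D → DTree D → Prop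
  | refl (n : ℕ) (s : DTree D) : DeepRed Z n s s
  | step {n d : ℕ} {s t : DTree D} (h : Step Z d s t) (hn : n ≤ d) : DeepRed Z n s t
  | trans {n : ℕ} {s t p : DTree D} (h : DeepRed Z n s t) (h' : DeepRed Z n t p) : DeepRed Z n s p
  | lim {n : ℕ} {s : ℕ → DTree D} {t : DTree D} (h : ∀ k, DeepRed Z (k + n) (s k) (s (k + 1)))
      (ht : ∀ k, AgreeTo k (s k) t) : DeepRed Z n (s 0) t

namespace DeepRed

variable {n : ℕ} {s t : DTree D}

theorem mono {m : ℕ} (hmn : m ≤ n) (h : DeepRed Z n s t) : DeepRed Z m s t := by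
  induction h generalizing m with
  | refl n s => exact .refl m s
  | step h hn => exact .step h (hmn.trans hn)
  | trans _ _ ih ih' => exact .trans (ih hmn) (ih' hmn)
  | lim _ ht ih => exact .lim (fun k => ih k (Nat.add_le_add_left hmn k)) ht

theorem concl_eq (hZ : PreservesConcl Z) (h : DeepRed Z n s t) : s.concl = t.concl := by
  induction h with
  | refl => rfl
  | step h => exact (h.agreeTo hZ).concl_eq
  | trans _ _ ih ih' => exact ih.trans ih'
  | lim _ ht => exact (ht 0).concl_eq

theorem of_steps (h : Steps Z s t) : DeepRed Z 0 s t := by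
  induction h with
  | refl => exact .refl 0 s
  | tail _ h ih =>
    obtain ⟨d, h⟩ := h
    exact ih.trans (.step h (Nat.zero_le d))

theorem context (hZ : PreservesConcl Z) {r : R} {c : Fin (D r).arity → DTree D}
    (i : Fin (D r).arity) {u u' : DTree D} (h : DeepRed Z n u u')
    (hs : s.IsApp r (Function.update c i u)) (ht : t.IsApp r (Function.update c i u')) :
    DeepRed Z (n + ((D r).coind i).toNat) s t := by
  have exists_update {x y : DTree D} (hxy : x.concl = y.concl) {p : DTree D}
      (hp : p.IsApp r (Function.update c i x)) : ∃ q : DTree D, q.IsApp r (Function.update c i y) :=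
    hp.exists_replace fun j => by
      obtain rfl | hj := eq_or_ne j i
      · rw [Function.update_self, Function.update_self, hxy]
      · rw [Function.update_of_ne hj, Function.update_of_ne hj]
  induction h generalizing s t with
  | refl => exact hs.unique ht ▸ .refl _ s
  | @step n d x y h hn =>
    refine .step (.context i (u := y) ?_ hs ?_) (Nat.add_le_add_right hn _)
    · rwa [Function.update_self]
    · rwa [Function.update_idem]
  | trans h _ ih ih' =>
    obtain ⟨p, hp⟩ := exists_update (h.concl_eq hZ) hs
    exact (ih hs hp).trans (ih' hp ht)
  | @lim n x y _ hy ih =>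
    choose p hp using fun k => exists_update ((hy 0).concl_eq.trans (hy k).concl_eq.symm) hs
    obtain rfl := (hp 0).unique hs
    refine .lim (fun k => ?_) fun k => (hp k).agreeTo ht fun j => ?_
    · exact Nat.add_assoc k n _ ▸ ih k (hp k) (hp (k + 1))
    · refine AgreeTo.mono (Nat.sub_le k _) ?_
      obtain rfl | hj := eq_or_ne j i
      · simpa only [Function.update_self] using hy k
      · simpa only [Function.update_of_ne hj] using .refl _ _

theorem congr (hZ : PreservesConcl Z) {r : R} {c c' : Fin (D r).arity → DTree D}
    (hs : s.IsApp r c) (ht : t.IsApp r c')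
    (h : ∀ i, DeepRed Z (n - ((D r).coind i).toNat) (c i) (c' i)) : DeepRed Z n s t := by
  classical
  suffices H : ∀ I : Finset (Fin (D r).arity), ∃ p : DTree D,
      p.IsApp r (I.piecewise c' c) ∧ DeepRed Z n s p by
    obtain ⟨p, hp, hsp⟩ := H Finset.univ
    rw [Finset.piecewise_univ] at hp
    rwa [← hp.unique ht]
  intro I
  induction I using Finset.induction_on with
  | empty => exact ⟨s, by rwa [Finset.piecewise_empty], .refl n s⟩
  | insert i I hi ih =>
    obtain ⟨p, hp, hsp⟩ := ih
    obtain ⟨q, hq⟩ := hp.exists_replace (c' := (insert i I).piecewise c' c) fun j => by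
      obtain rfl | hj := eq_or_ne j i
      · simpa [hi] using (h j).concl_eq hZ
      · rw [I.piecewise_insert_of_ne c' c hj]
    have hpq : DeepRed Z (n - ((D r).coind i).toNat + ((D r).coind i).toNat) p q := by
      refine .context (c := I.piecewise c' c) hZ i (h i) ?_ ?_
      · rwa [← Finset.piecewise_eq_of_notMem I c' c hi, Function.update_eq_self]
      · rwa [← Finset.piecewise_insert]
    exact ⟨q, hq, hsp.trans (hpq.mono le_tsub_add)⟩

end DeepRed

/-! ### Realising closure under limits by ordinal sequences -/

namespace IsRun

variable {P : ℕ → DTree D → DTree D → Prop} {n : ℕ} {a b c : Ordinal.{w}}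
  {f f' : Ordinal.{w} → DTree D} {d d' : Ordinal.{w} → ℕ}

theorem refl (P : ℕ → DTree D → DTree D → Prop) (n : ℕ) (a : Ordinal.{w})
    (f : Ordinal.{w} → DTree D) (d : Ordinal.{w} → ℕ) : IsRun P n a a f d := by
  constructor <;> simp

theorem single (hP : P (d a) (f a) (f (a + 1))) (hn : n ≤ d a) : IsRun P n a (a + 1) f d := by
  have eq_of_mem_Ico : ∀ δ ∈ Ico a (a + 1), δ = a := fun δ hδ =>
    le_antisymm (Order.lt_add_one_iff.1 hδ.2) hδ.1
  have not_isSuccLimit : ∀ l ∈ Ioc a (a + 1), ¬Order.IsSuccLimit l := fun l hl hlim =>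
    (hlim.add_one_lt hl.1).not_ge hl.2
  constructor
  · exact fun δ hδ => eq_of_mem_Ico δ hδ ▸ hP
  · exact fun δ hδ => eq_of_mem_Ico δ hδ ▸ hn
  · exact fun l hl hlim => absurd hlim (not_isSuccLimit l hl)
  · exact fun l hl hlim => absurd hlim (not_isSuccLimit l hl)

theorem exists_append (hab : a ≤ b) (hbc : b ≤ c) (h : IsRun P n a b f d)
    (h' : IsRun P n b c f' d') (hf : f b = f' b) :
    ∃ g e, IsRun P n a c g e ∧ g a = f a ∧ g c = f' c := by
  classical
  have hleft : EqOn ((Iic b).piecewise f f') f (Icc a b) :=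
    (piecewise_eqOn _ _ _).mono Icc_subset_Iic_self
  have hright : EqOn ((Iic b).piecewise f f') f' (Icc b c) := by
    intro δ hδ
    obtain rfl | hbδ := hδ.1.eq_or_lt
    · exact (hleft ⟨hab, le_rfl⟩).trans hf
    · exact piecewise_eq_of_notMem _ _ _ hbδ.not_ge
  refine ⟨_, (Iio b).piecewise d d', (h.congr hleft ?_).append (h'.congr hright ?_),
    hleft ⟨le_rfl, hab⟩, hright ⟨hbc, le_rfl⟩⟩
  · exact (piecewise_eqOn _ _ _).mono fun δ hδ => hδ.2
  · exact (piecewise_eqOn_compl _ _ _).mono fun δ hδ => hδ.1.not_gt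

end IsRun

theorem exists_eqOn_of_compatible {ι α β : Type*} [Nonempty β] {s : ι → Set α} {f : ι → α → β}
    (hf : ∀ i j, ∀ x ∈ s i, x ∈ s j → f i x = f j x) : ∃ g : α → β, ∀ i, EqOn g (f i) (s i) := by
  have exists_value : ∀ x, ∃ y, ∀ i, x ∈ s i → y = f i x := by
    intro x
    by_cases hx : ∃ i, x ∈ s i
    · obtain ⟨i, hi⟩ := hx
      exact ⟨f i x, fun j hj => hf i j x hi hj⟩
    · exact ⟨Classical.arbitrary β, fun i hi => absurd ⟨i, hi⟩ hx⟩
  choose g hg using exists_value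
  exact ⟨g, fun i x hi => hg x i hi⟩

theorem exists_eqOn_Icc_of_consecutive {α β : Type*} [LinearOrder α] [Nonempty β] {b : ℕ → α}
    (hb : Monotone b) {f : ℕ → α → β} (hf : ∀ k, f k (b (k + 1)) = f (k + 1) (b (k + 1))) :
    ∃ g : α → β, ∀ k, EqOn g (f k) (Icc (b k) (b (k + 1))) := by
  apply exists_eqOn_of_compatible
  intro j k x hj hk
  wlog hjk : j ≤ k generalizing j k
  · exact (this k j hk hj (le_of_not_ge hjk)).symm
  induction k, hjk using Nat.le_induction with
  | base => rfl
  | succ k hjk ih =>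
    have hx : x = b (k + 1) := le_antisymm (hj.2.trans (hb (by omega))) hk.1
    rw [ih ⟨(hb k.le_succ).trans hk.1, hx.le⟩, hx, hf k]

theorem exists_eqOn_Ico {α β : Type*} [LinearOrder α] [Nonempty β] {b : ℕ → α} (hb : Monotone b)
    (f : ℕ → α → β) : ∃ g : α → β, ∀ k, EqOn g (f k) (Ico (b k) (b (k + 1))) := by
  apply exists_eqOn_of_compatible
  intro j k x hj hk
  by_contra hne
  have hjk : j ≠ k := fun h => hne (h ▸ rfl)
  exact disjoint_left.1 (hb.pairwise_disjoint_on_Ico_succ hjk) hj hk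

theorem IsRun.exists_of_consecutive {P : ℕ → DTree D → DTree D → Prop} {n : ℕ → ℕ}
    {b : ℕ → Ordinal.{w}} (hb : Monotone b) {f : ℕ → Ordinal.{w} → DTree D}
    {d : ℕ → Ordinal.{w} → ℕ} (h : ∀ k, IsRun P (n k) (b k) (b (k + 1)) (f k) (d k))
    (hf : ∀ k, f k (b (k + 1)) = f (k + 1) (b (k + 1))) :
    ∃ g e, (∀ k, IsRun P (n k) (b k) (b (k + 1)) g e) ∧ ∀ k, g (b k) = f k (b k) := by
  have : Nonempty (DTree D) := ⟨f 0 0⟩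
  obtain ⟨g, hg⟩ := exists_eqOn_Icc_of_consecutive hb hf
  obtain ⟨e, he⟩ := exists_eqOn_Ico hb d
  exact ⟨g, e, fun k => (h k).congr (hg k) (he k), fun k => hg k ⟨le_rfl, hb k.le_succ⟩⟩

theorem IsRun.iSup {P : ℕ → DTree D → DTree D → Prop} (hP : ∀ d s t, P d s t → AgreeTo d s t)
    {n : ℕ} {b : ℕ → Ordinal.{w}} (hb : Monotone b) {f : Ordinal.{w} → DTree D}
    {d : Ordinal.{w} → ℕ} (h : ∀ k, IsRun P (k + n) (b k) (b (k + 1)) f d)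
    (hlim : ∀ k, AgreeTo k (f (b k)) (f (⨆ k, b k))) : IsRun P n (b 0) (⨆ k, b k) f d := by
  have hrun : ∀ j k, j ≤ k → IsRun P (j + n) (b j) (b k) f d := by
    intro j k hjk
    induction k, hjk using Nat.le_induction with
    | base => exact .refl P _ _ f d
    | succ k hjk ih =>
      have hdepth := (h k).le_depth
      exact ih.append ((h k).of_le_depth fun δ hδ => le_trans (by omega) (hdepth δ hδ))
  have exists_run : ∀ k, ∀ δ ∈ Ico (b k) (⨆ k, b k),
      ∃ c > δ, IsRun P (k + n) (b k) c f d := by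
    rintro k δ ⟨-, hδ⟩
    obtain ⟨j, hj⟩ := Ordinal.lt_iSup_iff.1 hδ
    exact ⟨b (max k j), hj.trans_le (hb (le_max_right k j)), hrun k _ (le_max_left k j)⟩
  constructor
  · intro δ hδ
    obtain ⟨c, hc, hrun⟩ := exists_run 0 δ hδ
    exact hrun.step δ ⟨hδ.1, hc⟩
  · intro δ hδ
    obtain ⟨c, hc, hrun⟩ := exists_run 0 δ hδ
    exact (Nat.le_add_left n 0).trans (hrun.le_depth δ ⟨hδ.1, hc⟩)
  · intro l hl hl_lim k
    by_cases hlb : ∃ j, l ≤ b j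
    · obtain ⟨j, hj⟩ := hlb
      exact (hrun 0 j j.zero_le).eventually_agreeTo l ⟨hl.1, hj⟩ hl_lim k
    · push Not at hlb
      obtain rfl : l = ⨆ k, b k := le_antisymm hl.2 (Ordinal.iSup_le fun j => (hlb j).le)
      filter_upwards [Ico_mem_nhdsLT (hlb k)] with δ hδ
      obtain ⟨c, hc, hrun⟩ := exists_run k δ hδ
      have hkδ := hrun.agreeTo hP δ ⟨hδ.1, hc.le⟩
      exact (hkδ.mono (Nat.le_add_right k n)).symm.trans (hlim k)
  · intro l hl hl_lim
    by_cases hlb : ∃ j, l ≤ b j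
    · obtain ⟨j, hj⟩ := hlb
      exact (hrun 0 j j.zero_le).tendsto_depth l ⟨hl.1, hj⟩ hl_lim
    · push Not at hlb
      refine tendsto_atTop.2 fun k => ?_
      filter_upwards [Ico_mem_nhdsLT (hlb k)] with δ hδ
      obtain ⟨c, hc, hrun⟩ := exists_run k δ ⟨hδ.1, hδ.2.trans_le hl.2⟩
      exact (Nat.le_add_right k n).trans (hrun.le_depth δ ⟨hδ.1, hc⟩)

theorem IsRun.exists_iSup {P : ℕ → DTree D → DTree D → Prop}
    (hP : ∀ d s t, P d s t → AgreeTo d s t) {n : ℕ} {b : ℕ → Ordinal.{w}} (hb : Monotone b)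
    {f : Ordinal.{w} → DTree D} {d : Ordinal.{w} → ℕ} {t : DTree D}
    (h : ∀ k, IsRun P (k + n) (b k) (b (k + 1)) f d) (ht : ∀ k, AgreeTo k (f (b k)) t) :
    ∃ g, IsRun P n (b 0) (⨆ k, b k) g d ∧ g (b 0) = f (b 0) ∧ g (⨆ k, b k) = t := by
  -- The supremum is attained if almost all segments are empty, and then `f` has a value there.
  have eq_of_attained : ∀ k, ⨆ k, b k ≤ b k → t = f (⨆ k, b k) := by
    intro k hk
    refine eq_of_forall_agreeTo fun j => AgreeTo.symm ?_
    have hsup : ⨆ k, b k = b (max j k) :=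
      le_antisymm (hk.trans (hb (le_max_right j k))) (Ordinal.le_iSup b _)
    exact hsup ▸ (ht (max j k)).mono (le_max_left j k)
  have hg : ∀ k, EqOn (Function.update f (⨆ k, b k) t) f (Icc (b k) (b (k + 1))) := by
    intro k δ hδ
    obtain rfl | hne := eq_or_ne δ (⨆ k, b k)
    · rw [Function.update_self]
      exact eq_of_attained (k + 1) hδ.2
    · exact Function.update_of_ne hne _ _
  have hgb : ∀ k, Function.update f (⨆ k, b k) t (b k) = f (b k) :=
    fun k => hg k ⟨le_rfl, hb k.le_succ⟩
  refine ⟨_, .iSup hP hb (fun k => (h k).congr (hg k) fun _ _ => rfl) fun k => ?_, hgb 0,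
    Function.update_self ..⟩
  rw [hgb, Function.update_self]
  exact ht k

theorem DeepRed.exists_isRun (hZ : PreservesConcl Z) {n : ℕ} {s t : DTree D}
    (h : DeepRed Z n s t) (a : Ordinal.{w}) :
    ∃ b ≥ a, ∃ f d, IsRun (Step Z) n a b f d ∧ f a = s ∧ f b = t := by
  induction h generalizing a with
  | refl n s => exact ⟨a, le_rfl, fun _ => s, fun _ => 0, .refl _ _ _ _ _, rfl, rfl⟩
  | @step n d s t h hn =>
    have hsource : Function.update (fun _ => t) a s a = s := Function.update_self ..
    have htarget : Function.update (fun _ => t) a s (a + 1) = t :=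
      Function.update_of_ne (lt_add_one a).ne' _ _
    refine ⟨a + 1, Order.le_succ a, _, fun _ => d, .single ?_ hn, hsource, htarget⟩
    rwa [hsource, htarget]
  | trans _ _ ih ih' =>
    obtain ⟨b, hab, f, d, h, rfl, rfl⟩ := ih a
    obtain ⟨c, hbc, f', d', h', hf', rfl⟩ := ih' b
    obtain ⟨g, e, hg, hga, hgc⟩ := h.exists_append hab hbc h' hf'.symm
    exact ⟨c, hab.trans hbc, g, e, hg, hga, hgc⟩
  | @lim n s t _ ht ih =>
    choose B hB F E hrun hsource htarget using ih
    let b : ℕ → Ordinal.{w} := fun k => Nat.rec a B k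
    have hb : Monotone b := monotone_nat_of_le_succ fun k => hB k (b k)
    obtain ⟨f, d, hf, hfb⟩ := IsRun.exists_of_consecutive hb (fun k => hrun k (b k)) fun k =>
      (htarget k (b k)).trans (hsource (k + 1) (b (k + 1))).symm
    have hs : ∀ k, f (b k) = s k := fun k => (hfb k).trans (hsource k (b k))
    obtain ⟨g, hg, hga, hgt⟩ := IsRun.exists_iSup (fun _ _ _ h => h.agreeTo hZ) hb hf fun k =>
      (hs k).symm ▸ ht k
    exact ⟨⨆ k, b k, Ordinal.le_iSup b 0, g, d, hg, hga.trans (hs 0), hgt⟩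

theorem DeepRed.infRed (hZ : PreservesConcl Z) {n : ℕ} {s t : DTree D} (h : DeepRed Z n s t) :
    InfRed.{u, v, w} Z s t := by
  obtain ⟨γ, -, f, d, hrun, hs, ht⟩ := h.exists_isRun hZ 0
  have hrun₀ := hrun.of_le_depth fun _ _ => Nat.zero_le _
  exact ⟨γ, nonempty_stronglyConvergingSeq_iff.2 ⟨f, d, hrun₀, hs, ht⟩⟩

/-! ### From derivations to infinitary reductions -/

/-- `s` and `t` coincide up to depth `k`, and their subtrees at depth `k` are related by `X`. -/
inductive RelatedBelow (X : DTree D → DTree D → Prop) : ℕ → DTree D → DTree D → Prop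
  | base {s t : DTree D} (h : X s t) : RelatedBelow X 0 s t
  | node {k : ℕ} {r : R} {c c' : Fin (D r).arity → DTree D} {s t : DTree D} (hs : s.IsApp r c)
      (ht : t.IsApp r c')
      (h : ∀ i, RelatedBelow X (k + 1 - ((D r).coind i).toNat) (c i) (c' i)) :
      RelatedBelow X (k + 1) s t

section

variable {X : DTree D → DTree D → Prop}

theorem RelatedBelow.agreeTo (hX : PreservesConcl X) {k : ℕ} {s t : DTree D}
    (h : RelatedBelow X k s t) : AgreeTo k s t := by
  induction h with
  | base h => exact agreeTo_zero.2 (hX _ _ h)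
  | node hs ht _ ih => exact hs.agreeTo ht ih

theorem RelatedBelow.refine (hZ : PreservesConcl Z)
    (hX : ∀ s t, X s t → ∃ s', DeepRed Z 0 s s' ∧ RelatedBelow X 1 s' t)
    {k : ℕ} {s t : DTree D} (h : RelatedBelow X k s t) :
    ∃ s', DeepRed Z k s s' ∧ RelatedBelow X (k + 1) s' t := by
  induction h with
  | base h => exact hX _ _ h
  | @node k r c c' s t hs ht _ ih =>
    choose x hx hxc using ih
    obtain ⟨s', hs'⟩ := hs.exists_replace fun i => (hx i).concl_eq hZ
    refine ⟨s', .congr hZ hs hs' hx, .node hs' ht fun i => ?_⟩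
    rw [Nat.sub_add_comm ((Bool.toNat_le _).trans (Nat.le_add_left 1 k))]
    exact hxc i

theorem DeepRed.coinduction (hZ : PreservesConcl Z) (hXconcl : PreservesConcl X)
    (hX : ∀ s t, X s t → ∃ s', DeepRed Z 0 s s' ∧ RelatedBelow X 1 s' t) {s t : DTree D}
    (h : X s t) : DeepRed Z 0 s t := by
  have exists_next : ∀ (k : ℕ) (s : {s : DTree D // RelatedBelow X k s t}),
      ∃ s' : {s' : DTree D // RelatedBelow X (k + 1) s' t}, DeepRed Z k s.1 s'.1 := by
    rintro k ⟨s, hs⟩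
    obtain ⟨s', hss', hs'⟩ := hs.refine hZ hX
    exact ⟨⟨s', hs'⟩, hss'⟩
  choose next hnext using exists_next
  let x : ∀ k, {s : DTree D // RelatedBelow X k s t} := fun k => Nat.rec ⟨s, .base h⟩ next k
  exact .lim (s := fun k => (x k).1) (fun k => hnext k (x k)) fun k => (x k).2.agreeTo hXconcl

end

section

variable {X : Ordinal.{w} → DTree D → DTree D → Prop} {γ : Ordinal.{w}} {s t : DTree D}

theorem LiftRule.concl_eq (h : LiftRule Z X γ s t) : s.concl = t.concl := by
  cases h with
  | lift r hs ht hst => exact hst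

theorem LiftRule.splitRule (h : LiftRule Z X γ s t) : SplitRule Z X γ s t :=
  .split (.nil .refl) h

theorem InterleavedSeq.concl_eq (hZ : PreservesConcl Z) {m : ℕ}
    (h : InterleavedSeq Z X γ m s t) : s.concl = t.concl := by
  induction m generalizing s with
  | zero =>
    cases h with
    | nil h => exact h.concl_eq hZ
  | succ m ih =>
    cases h with
    | cons h₁ _ h₂ h₃ => exact (h₁.concl_eq hZ).trans (h₂.concl_eq.trans (ih h₃))

theorem SplitRule.preservesConcl (hZ : PreservesConcl Z) : PreservesConcl (SplitRule Z X γ) := by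
  rintro s t ⟨h, h'⟩
  exact (h.concl_eq hZ).trans h'.concl_eq

theorem InterleavedSeq.deepRed (ih : ∀ δ < γ, ∀ s t, SplitRule Z X δ s t → DeepRed Z 0 s t)
    {m : ℕ} (h : InterleavedSeq Z X γ m s t) : DeepRed Z 0 s t := by
  induction m generalizing s with
  | zero =>
    cases h with
    | nil h => exact .of_steps h
  | succ m ihm =>
    cases h with
    | cons h₁ hδ h₂ h₃ =>
      exact (DeepRed.of_steps h₁).trans ((ih _ hδ _ _ h₂.splitRule).trans (ihm h₃))

theorem SplitRule.refine (hZ : PreservesConcl Z)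
    (hX : ∀ δ s' t', X δ s' t' → SplitRule Z X δ s' t')
    (ih : ∀ δ < γ, ∀ s t, SplitRule Z X δ s t → DeepRed Z 0 s t) (h : SplitRule Z X γ s t) :
    ∃ s', DeepRed Z 0 s s' ∧ RelatedBelow (SplitRule Z X γ) 1 s' t := by
  induction t using inductive_premiss_induction generalizing s with
  | H t r c' ht ih_ind =>
    obtain ⟨hseq, @⟨_, r', c, d, s₁, _, hs₁, ht', -, hcoind, hind⟩⟩ := h
    obtain rfl := ht.rule_eq ht'
    obtain rfl := ht.children_eq ht'
    have refine_child : ∀ i, ∃ x, DeepRed Z 0 (c i) x ∧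
        RelatedBelow (SplitRule Z X γ) (0 + 1 - ((D r).coind i).toNat) x (c' i) := by
      intro i
      cases hi : (D r).coind i with
      | false => exact ih_ind i hi (hind i hi)
      | true => exact ⟨c i, .refl 0 _, .base (hX _ _ _ (hcoind i hi))⟩
    choose x hx hxc using refine_child
    obtain ⟨s', hs'⟩ := hs₁.exists_replace fun i => (hx i).concl_eq hZ
    refine ⟨s', (hseq.deepRed ih).trans (.congr hZ hs₁ hs' fun i => ?_), .node hs' ht hxc⟩
    exact (hx i).mono (Nat.zero_sub _).le

theorem SplitRule.deepRed (hZ : PreservesConcl Z)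
    (hX : ∀ δ s' t', X δ s' t' → SplitRule Z X δ s' t') (h : SplitRule Z X γ s t) :
    DeepRed Z 0 s t := by
  induction γ using WellFoundedLT.induction generalizing s t with
  | _ γ ih =>
    exact .coinduction hZ (preservesConcl hZ)
      (fun _ _ h' => h'.refine hZ hX fun δ hδ _ _ h'' => ih δ hδ h'') h

theorem CoindRed.infRed (hZ : PreservesConcl Z) (h : CoindRed Z γ s t) :
    InfRed.{u, v, w} Z s t := by
  obtain ⟨X, hX, hst⟩ := h
  exact ((hX γ s t hst).deepRed hZ hX).infRed hZ

end

end Composition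

theorem mainTheorem1 {S : Type u} {R : Type v} (D : R → DerivationRule S)
    (Z : DTree D → DTree D → Prop) (hZ : ∀ s t, Z s t → s.concl = t.concl) (s t : DTree D) :
    InfRed.{u, v, w} Z s t ↔ ∃ γ : Ordinal.{w}, γ < ω₁ ∧ CoindRed Z γ s t := by
  constructor
  · rintro ⟨γ, hγ⟩
    obtain ⟨f, d, hrun, rfl, rfl⟩ := nonempty_stronglyConvergingSeq_iff.1 hγ
    exact ⟨γ, hrun.lt_omega_one, hrun.lazyRed.coindRed hZ⟩
  · rintro ⟨γ, -, hst⟩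
    exact hst.infRed hZ
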